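/- Let $m,n$ be integers with $2\le m<n\le \frac{m(m+1)}{2}$, and let $\mathrm{GNLA}(m,n)$ be the set of all real $n$-dimensional step-$2$ graded Lie algebras $\mathfrak g=V_1\oplus V_2$ (so $[V_1,V_1]\subseteq V_2\neq 0$ and $[V_1,V_2]=[V_2,V_2]=0$) that are generated by the homogeneous component $V_1$ and have $\dim V_1=m$. Assume that we are in neither of the following two cases: (1) $m=n-1$ with $n$ even; (2) $(m,n)=(4,6)$. Then a generic element of $\mathrm{GNLA}(m,n)$ cannot be represented as a direct sum of two nonzero graded Lie algebras (a summand may be commutative). Here "generic" means: there is a real polynomial $P$ in the structure constants $c_{ij}^k$ ($1\le i,j\le m$, $1\le k\le n-m$), defined by $[X_i,X_j]=\sum_k c_{ij}^k Y_k$ for a basis $(X_i)$ of $V_1$ and a basis $(Y_k)$ of $V_2$, such that $P(c)\ne 0$ for at least one element of $\mathrm{GNLA}(m,n)$ and some such bases, and such that every element of $\mathrm{GNLA}(m,n)$ with $P(c)\neq0$ for some such bases is not a direct sum of two nonzero graded Lie algebras. (The possible arrays $c$ form a nonempty Zariski open subset of the space of all arrays skew-symmetric in $i,j$, so $P\neq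 0$ is a nonempty Zariski open, hence open and dense, condition.) -/

import Mathlib

universe u

/-- An element of `GNLA(m, n)`: a real `n`-dimensional step `2` graded Lie algebra
`𝔤 = V₁ ⊕ V₂` that is generated by its homogeneous component `V₁`, with `dim V₁ = m`.
(For a grading concentrated in degrees `1` and `2`, `[Vᵢ, Vⱼ] ⊆ Vᵢ₊ⱼ` says that `[V₁, V₁] ⊆ V₂`,
`[V₁, V₂] = 0` and `[V₂, V₂] = 0`.) -/
structure GNLA (m n : ℕ) : Type (u + 1) where
  /-- The underlying Lie algebra. -/
  carrier : Type u
  [lieRing : LieRing carrier]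
  [lieAlgebra : LieAlgebra ℝ carrier]
  /-- The homogeneous component of degree `1`. -/
  V₁ : Submodule ℝ carrier
  /-- The homogeneous component of degree `2`. -/
  V₂ : Submodule ℝ carrier
  isCompl : IsCompl V₁ V₂
  lie_mem : ∀ x ∈ V₁, ∀ y ∈ V₁, ⁅x, y⁆ ∈ V₂
  lie_one_two : ∀ x ∈ V₁, ∀ z ∈ V₂, ⁅x, z⁆ = 0
  lie_two_two : ∀ z ∈ V₂, ∀ w ∈ V₂, ⁅z, w⁆ = 0
  generates : LieSubalgebra.lieSpan ℝ carrier (V₁ : Set carrier) = ⊤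
  step_two : V₂ ≠ ⊥
  finiteDimensional : FiniteDimensional ℝ carrier
  finrank_carrier : Module.finrank ℝ carrier = n
  finrank_V₁ : Module.finrank ℝ V₁ = m

namespace GNLA

attribute [instance] GNLA.lieRing GNLA.lieAlgebra GNLA.finiteDimensional

variable {m n : ℕ}

/-- A Lie ideal is graded (homogeneous) if it is spanned by its homogeneous components. -/
def IsGradedIdeal (g : GNLA.{u} m n) (I : LieIdeal ℝ g.carrier) : Prop :=
  I.toSubmodule = (I.toSubmodule ⊓ g.V₁) ⊔ (I.toSubmodule ⊓ g.V₂)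

/-- `𝔤` is the direct sum of two nonzero graded Lie algebras: there are two nonzero graded ideals
of `𝔤` such that `𝔤`, as a vector space, is their direct sum. (A summand may be commutative.) -/
def IsDecomposable (g : GNLA.{u} m n) : Prop :=
  ∃ I J : LieIdeal ℝ g.carrier, I ≠ ⊥ ∧ J ≠ ⊥ ∧ g.IsGradedIdeal I ∧ g.IsGradedIdeal J ∧
    IsCompl I.toSubmodule J.toSubmodule

/-- The structure constants `c i j k` of `𝔤` with respect to a basis `X` of `V₁` and a basis `Y`
of `V₂`, that is, `[X i, X j] = ∑ k, c i j k • Y k`; the triples `(i, j, k)` are the indices. -/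
noncomputable def structureConstants (g : GNLA.{u} m n) (X : Module.Basis (Fin m) ℝ g.V₁)
    (Y : Module.Basis (Fin (n - m)) ℝ g.V₂) : Fin m × Fin m × Fin (n - m) → ℝ :=
  fun t => Y.repr
    ⟨⁅(X t.1 : g.carrier), (X t.2.1 : g.carrier)⁆,
      g.lie_mem _ (X t.1).2 _ (X t.2.1).2⟩ t.2.2

/-- A property `Q` holds for a generic element of `GNLA(m, n)`: there is a polynomial `P` in the
structure constants which does not vanish at every element of `GNLA(m, n)`, such that `Q` holds for
every element that has a basis, adapted to the grading, in which `P` is nonzero at the structure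
constants. The arrays of structure constants of elements of `GNLA(m, n)` form a Zariski open subset
of the vector space of all arrays that are skew-symmetric in `i, j`, hence an irreducible variety,
so `P ≠ 0` defines a nonempty Zariski open, in particular open and dense, set of them. -/
def IsGeneric (Q : GNLA.{u} m n → Prop) : Prop :=
  ∃ P : MvPolynomial (Fin m × Fin m × Fin (n - m)) ℝ,
    (∃ (g : GNLA.{u} m n) (X : Module.Basis (Fin m) ℝ g.V₁)
        (Y : Module.Basis (Fin (n - m)) ℝ g.V₂),
      MvPolynomial.eval (g.structureConstants X Y) P ≠ 0) ∧
    ∀ (g : GNLA.{u} m n) (X : Module.Basis (Fin m) ℝ g.V₁)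
        (Y : Module.Basis (Fin (n - m)) ℝ g.V₂),
      MvPolynomial.eval (g.structureConstants X Y) P ≠ 0 → Q g

end GNLA

/-! A decomposition of `𝔤` into graded ideals gives the projection onto one summand: a graded map
that commutes with brackets, is the identity on one nonzero ideal and zero on the other. It is a
non-scalar element of the centroid, so a trivial centroid excludes every decomposition
(`IsDecomposable.not_hasTrivialCentroid`). The centroid is the solution space of a linear system
whose coefficients are structure constants, so its triviality is Zariski open
(`HasTrivialCentroid.exists_mvPolynomial`). One skew array with trivial centroid therefore suffices;
such an array is automatically realised, because trivial centroid forces the brackets to span `V₂`.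

With k = n - m, the array is a k-tuple of skew forms on `V₁`. If m is even and k = 1, a symplectic
form works; if m is even and k = 2, a pencil with r = m/2 ≥ 3 distinct eigenvalues does. In the
other cases a stronger property holds: only scalars are self-adjoint for all the forms. It survives
the addition of independent forms, so small k suffices: the Kronecker pencil for m odd and k = 2
(`existsRigidForms_kronecker`), and that pencil enlarged by one vector and one form for m even and k
= 3 (`ExistsRigidForms.sum_unit`). -/

/-- The array `c` has trivial centroid: the only pairs `(S, T)` of endomorphisms of `V₁` and `V₂`
with `[S x, y] = T [x, y]` are the scalars. -/
def HasTrivialCentroid {ι κ : Type*} [Fintype ι] [Fintype κ] [DecidableEq ι] [DecidableEq κ]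
    (c : ι × ι × κ → ℝ) : Prop :=
  ∀ (S : Matrix ι ι ℝ) (T : Matrix κ κ ℝ),
    (∀ i j l, ∑ p, S i p * c (p, j, l) = ∑ q, T l q * c (i, j, q)) →
      ∃ a : ℝ, S = a • (1 : Matrix ι ι ℝ) ∧ T = a • (1 : Matrix κ κ ℝ)

/-! ### Zariski openness of trivial centroid -/

section Polynomial

variable {ι κ : Type*} [DecidableEq ι] [DecidableEq κ]

/-- The matrix of the linear system defining the centroid of the array `c`, together with the
equation `S i₀ i₀ = 0`. -/
def centroidMatrix {R : Type*} [CommRing R] (i₀ : ι) (c : ι × ι × κ → R) :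
    Matrix ((ι × ι × κ) ⊕ Unit) ((ι × ι) ⊕ (κ × κ)) R
  | .inl (i, j, l), .inl (i', p) => if i = i' then c (p, j, l) else 0
  | .inl (i, j, l), .inr (l', q) => if l = l' then -c (i, j, q) else 0
  | .inr _, .inl (i', p) => if i' = i₀ ∧ p = i₀ then 1 else 0
  | .inr _, .inr _ => 0

theorem centroidMatrix_map {R R' : Type*} [CommRing R] [CommRing R'] (f : R →+* R') (i₀ : ι)
    (c : ι × ι × κ → R) :
    (centroidMatrix i₀ c).map f = centroidMatrix i₀ (fun t => f (c t)) := by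
  ext (⟨i, j, l⟩ | _) (⟨i', p⟩ | ⟨l', q⟩) <;> simp [centroidMatrix, apply_ite f]

variable [Fintype ι] [Fintype κ]

theorem centroidMatrix_mulVec_inl (i₀ : ι) (c : ι × ι × κ → ℝ) (v : (ι × ι) ⊕ (κ × κ) → ℝ)
    (i j : ι) (l : κ) :
    (centroidMatrix i₀ c).mulVec v (.inl (i, j, l)) =
      ∑ p, v (.inl (i, p)) * c (p, j, l) - ∑ q, v (.inr (l, q)) * c (i, j, q) := by
  simp only [Matrix.mulVec, dotProduct, Fintype.sum_sum_type, Fintype.sum_prod_type,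
    centroidMatrix, ite_mul, zero_mul]
  rw [Finset.sum_eq_single i (fun b _ hb => by simp [hb.symm]) (by simp),
    Finset.sum_eq_single l (fun b _ hb => by simp [hb.symm]) (by simp)]
  simp [sub_eq_add_neg, mul_comm]

theorem centroidMatrix_mulVec_inr (i₀ : ι) (c : ι × ι × κ → ℝ) (v : (ι × ι) ⊕ (κ × κ) → ℝ) :
    (centroidMatrix i₀ c).mulVec v (.inr ()) = v (.inl (i₀, i₀)) := by
  simp only [Matrix.mulVec, dotProduct, Fintype.sum_sum_type, Fintype.sum_prod_type,
    centroidMatrix, ite_mul, zero_mul, one_mul, ite_and]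
  simp

/-- Scalar pairs always solve the centroid equations. The extra equation `S i₀ i₀ = 0` removes
exactly this line, so triviality becomes injectivity of a matrix. -/
theorem hasTrivialCentroid_iff (i₀ : ι) (c : ι × ι × κ → ℝ) :
    HasTrivialCentroid c ↔ ∀ v, (centroidMatrix i₀ c).mulVec v = 0 → v = 0 := by
  constructor
  · intro h v hv
    obtain ⟨a, hS, hT⟩ := h (fun i p => v (.inl (i, p))) (fun l q => v (.inr (l, q)))
      (fun i j l => by
        have := congrFun hv (.inl (i, j, l))
        rw [centroidMatrix_mulVec_inl] at this
        exact sub_eq_zero.mp this)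
    have h0 := congrFun hv (.inr ())
    rw [centroidMatrix_mulVec_inr] at h0
    have ha := congrFun (congrFun hS i₀) i₀
    simp only [Matrix.smul_apply, Matrix.one_apply_eq, smul_eq_mul, mul_one] at ha
    have ha0 : a = 0 := ha.symm.trans h0
    subst ha0
    ext (⟨i, p⟩ | ⟨l, q⟩)
    · simpa using congrFun (congrFun hS i) p
    · simpa using congrFun (congrFun hT l) q
  · intro h S T hST
    let a := S i₀ i₀
    let v : (ι × ι) ⊕ (κ × κ) → ℝ := Sum.elim
      (fun t => (S - a • (1 : Matrix ι ι ℝ)) t.1 t.2) (fun t => (T - a • (1 : Matrix κ κ ℝ)) t.1 t.2)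
    have hv : v = 0 := by
      apply h
      ext (⟨i, j, l⟩ | _)
      · rw [centroidMatrix_mulVec_inl]
        simp [v, sub_mul, Finset.sum_sub_distrib, hST, Matrix.one_apply]
      · rw [show (.inr _ : (ι × ι × κ) ⊕ Unit) = .inr () from rfl, centroidMatrix_mulVec_inr]
        simp [v, a]
    refine ⟨a, sub_eq_zero.mp ?_, sub_eq_zero.mp ?_⟩
    · ext i p
      exact congrFun hv (.inl (i, p))
    · ext l q
      exact congrFun hv (.inr (l, q))

/-- Triviality of the centroid is a Zariski open condition. -/
theorem HasTrivialCentroid.exists_mvPolynomial [Nonempty ι] {c₀ : ι × ι × κ → ℝ}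
    (h : HasTrivialCentroid c₀) :
    ∃ P : MvPolynomial (ι × ι × κ) ℝ, MvPolynomial.eval c₀ P ≠ 0 ∧
      ∀ c, MvPolynomial.eval c P ≠ 0 → HasTrivialCentroid c := by
  obtain ⟨i₀⟩ := ‹Nonempty ι›
  -- With M(c) the centroid matrix, P is det(M(c₀)ᵀ M(c)). At c₀ it is a Gram determinant, nonzero
  -- over ℝ because M(c₀) is injective; wherever it is nonzero, M(c) is injective.
  let A : Matrix ((ι × ι) ⊕ (κ × κ)) ((ι × ι × κ) ⊕ Unit) (MvPolynomial (ι × ι × κ) ℝ) :=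
    (centroidMatrix i₀ c₀).transpose.map MvPolynomial.C
  let B : Matrix ((ι × ι × κ) ⊕ Unit) ((ι × ι) ⊕ (κ × κ)) (MvPolynomial (ι × ι × κ) ℝ) :=
    centroidMatrix i₀ (fun t => MvPolynomial.X t)
  let P : MvPolynomial (ι × ι × κ) ℝ := (A * B).det
  have hP : ∀ c, MvPolynomial.eval c P =
      ((centroidMatrix i₀ c₀).transpose * centroidMatrix i₀ c).det := by
    intro c
    simp only [P]
    rw [RingHom.map_det, RingHom.mapMatrix_apply, Matrix.map_mul]
    simp only [A, B]
    rw [centroidMatrix_map,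
      Matrix.map_map]
    congr 2
    · ext
      simp
    · simp
  refine ⟨P, ?_, fun c hc => ?_⟩
  · rw [hP]
    intro h0
    obtain ⟨v, hv, hv0⟩ := Matrix.exists_mulVec_eq_zero_iff.mpr h0
    apply hv
    apply (hasTrivialCentroid_iff i₀ c₀).mp h
    have : dotProduct ((centroidMatrix i₀ c₀).mulVec v) ((centroidMatrix i₀ c₀).mulVec v) = 0 := by
      have h1 := congrArg (dotProduct v) hv0
      rwa [← Matrix.mulVec_mulVec, Matrix.dotProduct_mulVec, Matrix.vecMul_transpose,
        dotProduct_zero] at h1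
    exact dotProduct_self_eq_zero.mp this
  · rw [hP] at hc
    rw [hasTrivialCentroid_iff i₀]
    intro v hv
    by_contra hne
    refine hc (Matrix.exists_mulVec_eq_zero_iff.mp ⟨v, hne, ?_⟩)
    rw [← Matrix.mulVec_mulVec, hv, Matrix.mulVec_zero]

end Polynomial

/-! ### Decompositions give non-scalar centroid elements -/

/-- A projection along a decomposition into two homogeneous subspaces preserves the grading. -/
theorem Submodule.projection_mem_of_graded {E : Type*} [AddCommGroup E] [Module ℝ E]
    {A B I J : Submodule ℝ E} (hAB : Disjoint A B) (hIJ : IsCompl I J)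
    (hI : I = (I ⊓ A) ⊔ (I ⊓ B)) (hJ : J = (J ⊓ A) ⊔ (J ⊓ B)) {x : E} (hx : x ∈ A) :
    I.projection J hIJ x ∈ A := by
  obtain ⟨a, ha, b, hb, rfl⟩ := Submodule.mem_sup.mp
    (show x ∈ I ⊔ J from hIJ.sup_eq_top ▸ Submodule.mem_top)
  rw [map_add, Submodule.projection_apply_of_mem_left hIJ ha,
    Submodule.projection_apply_of_mem_right hIJ hb, add_zero]
  rw [hI] at ha
  rw [hJ] at hb
  obtain ⟨a₁, ha₁, a₂, ha₂, rfl⟩ := Submodule.mem_sup.mp ha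
  obtain ⟨b₁, hb₁, b₂, hb₂, rfl⟩ := Submodule.mem_sup.mp hb
  -- The B-component of x vanishes, so a₂ = -b₂ lies in both I and J.
  have h1 : a₂ + b₂ ∈ A := by
    have := A.sub_mem hx (A.add_mem ha₁.2 hb₁.2)
    rwa [show a₁ + a₂ + (b₁ + b₂) - (a₁ + b₁) = a₂ + b₂ by abel] at this
  have h2 : a₂ + b₂ = 0 := Submodule.disjoint_def.mp hAB _ h1 (B.add_mem ha₂.2 hb₂.2)
  have h3 : a₂ = 0 := by
    refine Submodule.disjoint_def.mp hIJ.disjoint _ ha₂.1 ?_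
    rw [eq_neg_of_add_eq_zero_left h2]
    exact J.neg_mem hb₂.1
  rw [h3, add_zero]
  exact ha₁.2

/-- The projection onto a Lie ideal along a complementary Lie ideal commutes with brackets. -/
theorem LieIdeal.projection_lie {L : Type*} [LieRing L] [LieAlgebra ℝ L] (I J : LieIdeal ℝ L)
    (h : IsCompl I.toSubmodule J.toSubmodule) (x y : L) :
    I.toSubmodule.projection J.toSubmodule h ⁅x, y⁆ =
      ⁅I.toSubmodule.projection J.toSubmodule h x, y⁆ := by
  obtain ⟨a, ha, b, hb, rfl⟩ := Submodule.mem_sup.mp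
    (show x ∈ I.toSubmodule ⊔ J.toSubmodule from h.sup_eq_top ▸ Submodule.mem_top)
  rw [add_lie, map_add, map_add, Submodule.projection_apply_of_mem_left h ha,
    Submodule.projection_apply_of_mem_right h hb,
    Submodule.projection_apply_of_mem_left h (lie_mem_left ℝ L I a y ha),
    Submodule.projection_apply_of_mem_right h (lie_mem_left ℝ L J b y hb), add_zero, add_zero]

theorem Module.Basis.eq_smul_id_of_repr {ι E : Type*} [Fintype ι] [DecidableEq ι] [AddCommGroup E]
    [Module ℝ E] (b : Module.Basis ι ℝ E) (f : E →ₗ[ℝ] E) (a : ℝ)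
    (h : ∀ i j, b.repr (f (b i)) j = (a • (1 : Matrix ι ι ℝ)) i j) (x : E) : f x = a • x := by
  have : f = a • LinearMap.id := by
    refine b.ext fun i => b.repr.injective (Finsupp.ext fun j => ?_)
    rw [h]
    simp [Matrix.one_apply, Finsupp.single_apply]
  simp [this]

theorem Module.Basis.sum_repr_mul_repr_apply {ι κ E F : Type*} [Fintype ι] [AddCommGroup E]
    [Module ℝ E] [AddCommGroup F] [Module ℝ F] (b : Module.Basis ι ℝ E) (b' : Module.Basis κ ℝ F)
    (f : E →ₗ[ℝ] F) (x : E) (l : κ) :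
    ∑ q, b.repr x q * b'.repr (f (b q)) l = b'.repr (f x) l := by
  have h : f x = ∑ q, b.repr x q • f (b q) := by
    conv_lhs => rw [← b.sum_repr x]
    simp only [map_sum, map_smul]
  simp [h]

namespace GNLA

variable {m n : ℕ}

theorem IsDecomposable.not_hasTrivialCentroid {g : GNLA.{u} m n} (hg : g.IsDecomposable)
    (X : Module.Basis (Fin m) ℝ g.V₁) (Y : Module.Basis (Fin (n - m)) ℝ g.V₂) :
    ¬ HasTrivialCentroid (g.structureConstants X Y) := by
  intro h
  obtain ⟨I, J, hI0, hJ0, hI, hJ, hIJ⟩ := hg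
  let p : g.carrier →ₗ[ℝ] g.carrier := I.toSubmodule.projection J.toSubmodule hIJ
  have hp₁ : ∀ x ∈ g.V₁, p x ∈ g.V₁ := fun x hx =>
    Submodule.projection_mem_of_graded g.isCompl.disjoint hIJ hI hJ hx
  have hp₂ : ∀ x ∈ g.V₂, p x ∈ g.V₂ := fun x hx =>
    Submodule.projection_mem_of_graded g.isCompl.disjoint.symm hIJ
      (hI.trans (sup_comm _ _)) (hJ.trans (sup_comm _ _)) hx
  let p₁ : g.V₁ →ₗ[ℝ] g.V₁ := p.restrict hp₁
  let p₂ : g.V₂ →ₗ[ℝ] g.V₂ := p.restrict hp₂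
  let br : Fin m → g.V₁ →ₗ[ℝ] g.V₂ := fun j =>
    { toFun := fun x => ⟨⁅(x : g.carrier), (X j : g.carrier)⁆, g.lie_mem _ x.2 _ (X j).2⟩
      map_add' := fun x y => Subtype.ext (by simp)
      map_smul' := fun r x => Subtype.ext (by simp) }
  have hbr : ∀ j x, p₂ (br j x) = br j (p₁ x) := fun j x =>
    Subtype.ext (LieIdeal.projection_lie I J hIJ x (X j))
  -- In the centroid equations `S` lists images of basis vectors by rows, `T` by columns.
  obtain ⟨a, hS, hT⟩ := h (fun i q => X.repr (p₁ (X i)) q) (fun l q => Y.repr (p₂ (Y q)) l) (by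
    intro i j l
    have h1 := X.sum_repr_mul_repr_apply Y (br j) (p₁ (X i)) l
    have h2 := Y.sum_repr_mul_repr_apply Y p₂ (br j (X i)) l
    rw [hbr, ← h1] at h2
    exact h2.symm.trans (Finset.sum_congr rfl fun q _ => mul_comm _ _))
  have e₁ : ∀ x, p₁ x = a • x :=
    X.eq_smul_id_of_repr p₁ a fun i j => congrFun (congrFun hS i) j
  have e₂ : ∀ x, p₂ x = a • x := by
    refine Y.eq_smul_id_of_repr p₂ a fun i j => ?_
    have := congrFun (congrFun hT j) i
    rw [Matrix.smul_apply, Matrix.one_apply] at this ⊢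
    simpa [eq_comm] using this
  have e : ∀ x, p x = a • x := by
    intro x
    obtain ⟨y, hy, z, hz, rfl⟩ := Submodule.mem_sup.mp
      (show x ∈ g.V₁ ⊔ g.V₂ from g.isCompl.sup_eq_top ▸ Submodule.mem_top)
    rw [map_add, smul_add]
    exact congrArg₂ (· + ·) (congrArg Subtype.val (e₁ ⟨y, hy⟩)) (congrArg Subtype.val (e₂ ⟨z, hz⟩))
  -- The scalar would have to be 1 on I and 0 on J, and both are nonzero.
  obtain ⟨x, hx, hx0⟩ := (Submodule.ne_bot_iff _).mp
    (mt (LieSubmodule.toSubmodule_eq_bot I).mp hI0)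
  obtain ⟨y, hy, hy0⟩ := (Submodule.ne_bot_iff _).mp
    (mt (LieSubmodule.toSubmodule_eq_bot J).mp hJ0)
  have hx1 : x = a • x := (Submodule.projection_apply_of_mem_left hIJ hx).symm.trans (e x)
  have hy1 : 0 = a • y := (Submodule.projection_apply_of_mem_right hIJ hy).symm.trans (e y)
  have ha : a = 0 := (smul_eq_zero.mp hy1.symm).resolve_right hy0
  rw [ha, zero_smul] at hx1
  exact hx0 hx1

end GNLA

/-! ### Realising an array by a graded Lie algebra -/

/-- The graded Lie ring structure on `V × W` given by an alternating bilinear map. -/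
abbrev LieRing.ofAlternating {V W : Type*} [AddCommGroup V] [Module ℝ V] [AddCommGroup W]
    [Module ℝ W] (B : V →ₗ[ℝ] V →ₗ[ℝ] W) (hB : ∀ x, B x x = 0) : LieRing (V × W) where
  bracket x y := (0, B x.1 y.1)
  add_lie x y z := by ext <;> simp
  lie_add x y z := by ext <;> simp
  lie_self x := by ext <;> simp [hB]
  leibniz_lie x y z := by ext <;> simp

/-- The Lie algebra structure on `V × W` given by an alternating bilinear map. -/
abbrev LieAlgebra.ofAlternating {V W : Type*} [AddCommGroup V] [Module ℝ V] [AddCommGroup W]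
    [Module ℝ W] (B : V →ₗ[ℝ] V →ₗ[ℝ] W) (hB : ∀ x, B x x = 0) :
    letI := LieRing.ofAlternating B hB
    LieAlgebra ℝ (V × W) :=
  letI := LieRing.ofAlternating B hB
  { lie_smul := fun t x y => by ext <;> simp [Bracket.bracket] }

namespace GNLA

variable {m n : ℕ}

/-- The element of `GNLA(m, n)` with `V₁ = V`, `V₂ = W` and a given bracket. -/
def ofAlternating {V W : Type u} [AddCommGroup V] [Module ℝ V] [AddCommGroup W]
    [Module ℝ W] [FiniteDimensional ℝ V] [FiniteDimensional ℝ W] [Nontrivial W]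
    (B : V →ₗ[ℝ] V →ₗ[ℝ] W) (hB : ∀ x, B x x = 0)
    (hspan : Submodule.span ℝ (Set.range fun t : V × V => B t.1 t.2) = ⊤)
    (hV : Module.finrank ℝ V = m) (hVW : Module.finrank ℝ V + Module.finrank ℝ W = n) :
    GNLA.{u} m n :=
  letI := LieRing.ofAlternating B hB
  letI := LieAlgebra.ofAlternating B hB
  { carrier := V × W
    V₁ := LinearMap.range (LinearMap.inl ℝ V W)
    V₂ := LinearMap.range (LinearMap.inr ℝ V W)
    isCompl := LinearMap.isCompl_range_inl_inr
    lie_mem := by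
      rintro x - y -
      exact ⟨B x.1 y.1, rfl⟩
    lie_one_two := by
      rintro x - _ ⟨z, rfl⟩
      exact Prod.ext rfl (map_zero (B x.1))
    lie_two_two := by
      rintro w - _ ⟨z, rfl⟩
      exact Prod.ext rfl (map_zero (B w.1))
    generates := by
      rw [eq_top_iff]
      set K := LieSubalgebra.lieSpan ℝ (V × W) (LinearMap.range (LinearMap.inl ℝ V W) : Set (V × W))
      have h1 : ∀ v : V, ((v, 0) : V × W) ∈ K := fun v =>
        LieSubalgebra.subset_lieSpan ⟨v, rfl⟩
      have h2 : (⊤ : Submodule ℝ W) ≤ K.toSubmodule.comap (LinearMap.inr ℝ V W) := by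
        rw [← hspan, Submodule.span_le]
        rintro _ ⟨⟨v, w⟩, rfl⟩
        exact K.lie_mem (h1 v) (h1 w)
      rintro ⟨v, w⟩ -
      have := K.add_mem (h1 v) (h2 (Submodule.mem_top : w ∈ ⊤))
      simpa using this
    step_two := by
      obtain ⟨w, hw⟩ := exists_ne (0 : W)
      refine (Submodule.ne_bot_iff _).mpr ⟨_, ⟨w, rfl⟩, ?_⟩
      simpa using hw
    finiteDimensional := inferInstance
    finrank_carrier := by rw [Module.finrank_prod, hVW]
    finrank_V₁ := by
      rw [LinearMap.finrank_range_of_inj LinearMap.inl_injective, hV] }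

/-- An array with trivial centroid which is skew-symmetric in `i, j` is the array of structure
constants of an element of `GNLA(m, n)`. -/
theorem exists_structureConstants_eq (hm : 0 < m) (hmn : m < n)
    {c : Fin m × Fin m × Fin (n - m) → ℝ} (hskew : ∀ i j l, c (i, j, l) = -c (j, i, l))
    (hc : HasTrivialCentroid c) :
    ∃ (g : GNLA.{u} m n) (X : Module.Basis (Fin m) ℝ g.V₁)
      (Y : Module.Basis (Fin (n - m)) ℝ g.V₂), g.structureConstants X Y = c := by
  -- `ULift` places the coordinate spaces in the universe `u` of the carriers.
  let V := ULift.{u} (Fin m) → ℝ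
  let W := ULift.{u} (Fin (n - m)) → ℝ
  have : Nonempty (ULift.{u} (Fin (n - m))) := ⟨⟨⟨0, by omega⟩⟩⟩
  let bV : Module.Basis (Fin m) ℝ V := (Pi.basisFun ℝ _).reindex Equiv.ulift
  let bW : Module.Basis (Fin (n - m)) ℝ W := (Pi.basisFun ℝ _).reindex Equiv.ulift
  let w : Fin m → Fin m → W := fun i j => ∑ l, c (i, j, l) • bW l
  let B : V →ₗ[ℝ] V →ₗ[ℝ] W := bV.constr ℝ fun i => bV.constr ℝ (w i)
  have hBb : ∀ i j, B (bV i) (bV j) = w i j := fun i j => by simp [B]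
  have hrepr : ∀ i j l, bW.repr (w i j) l = c (i, j, l) := fun i j l => by
    simp [w, Finsupp.single_apply]
  have hflip : B = -B.flip := bV.ext fun i => bV.ext fun j => by
    rw [LinearMap.neg_apply, LinearMap.neg_apply, LinearMap.flip_apply, hBb, hBb]
    exact bW.ext_elem fun l => by rw [map_neg, Finsupp.neg_apply, hrepr, hrepr, hskew]
  have hB : ∀ x, B x x = 0 := fun x => by
    have := congrFun (congrArg DFunLike.coe (congrFun (congrArg DFunLike.coe hflip) x)) x
    rw [LinearMap.neg_apply, LinearMap.neg_apply, LinearMap.flip_apply] at this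
    exact self_eq_neg.mp this
  have hspan : Submodule.span ℝ (Set.range fun t : V × V => B t.1 t.2) = ⊤ := by
    by_contra hne
    obtain ⟨f, hf0, hf⟩ := Submodule.exists_le_ker_of_lt_top _ (lt_top_iff_ne_top.mpr hne)
    have hfw : ∀ i j, f (w i j) = 0 := fun i j =>
      hf (Submodule.subset_span ⟨(bV i, bV j), hBb i j⟩)
    -- A functional f that kills all brackets makes S = 0 together with T : z ↦ f(z) · (sum of the
    -- basis vectors) a centroid pair. Since S = 0, the scalar is 0, so T = 0 and f = 0.
    obtain ⟨a, hS, hT⟩ := hc 0 (fun _ q => f (bW q)) (fun i j l => by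
      have := hfw i j
      simp only [w, map_sum, map_smul, smul_eq_mul] at this
      simp [this, mul_comm (f _)])
    have ha : a = 0 := by simpa using (congrFun (congrFun hS ⟨0, hm⟩) ⟨0, hm⟩).symm
    refine hf0 (bW.ext fun q => ?_)
    simpa [ha] using congrFun (congrFun hT q) q
  have hV : Module.finrank ℝ V = m := by simp [V]
  have hW : Module.finrank ℝ W = n - m := by simp [W]
  refine ⟨ofAlternating B hB hspan hV (by rw [hV, hW]; omega),
    bV.map (LinearEquiv.ofInjective (LinearMap.inl ℝ V W) LinearMap.inl_injective),
    bW.map (LinearEquiv.ofInjective (LinearMap.inr ℝ V W) LinearMap.inr_injective), ?_⟩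
  ext ⟨i, j, l⟩
  rw [← hrepr, ← hBb]
  exact congrArg (fun v => bW.repr v l) ((LinearEquiv.symm_apply_eq _).mpr (Subtype.ext rfl))

theorem isGeneric_of_hasTrivialCentroid (hm : 0 < m) (hmn : m < n)
    {c : Fin m × Fin m × Fin (n - m) → ℝ} (hskew : ∀ i j l, c (i, j, l) = -c (j, i, l))
    (hc : HasTrivialCentroid c) : IsGeneric (fun g : GNLA.{u} m n => ¬ g.IsDecomposable) := by
  have : Nonempty (Fin m) := ⟨⟨0, hm⟩⟩
  obtain ⟨P, hP, hP'⟩ := hc.exists_mvPolynomial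
  obtain ⟨g, X, Y, hg⟩ := exists_structureConstants_eq.{u} hm hmn hskew hc
  exact ⟨P, ⟨g, X, Y, hg ▸ hP⟩, fun g X Y h hd => hd.not_hasTrivialCentroid X Y (hP' _ h)⟩

end GNLA

/-! ### One form, and diagonal pencils, in even dimension -/

section TrivialCentroid

variable {ι κ : Type*} [Fintype ι] [Fintype κ] [DecidableEq ι] [DecidableEq κ]

theorem HasTrivialCentroid.comp_equiv {ι' : Type*} [Fintype ι'] [DecidableEq ι'] (e : ι' ≃ ι)
    {c : ι × ι × κ → ℝ} (hc : HasTrivialCentroid c) :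
    HasTrivialCentroid fun t : ι' × ι' × κ => c (e t.1, e t.2.1, t.2.2) := by
  intro S T h
  obtain ⟨a, hS, hT⟩ := hc (S.submatrix e.symm e.symm) T (fun i j l => by
    have := h (e.symm i) (e.symm j) l
    simp only [Equiv.apply_symm_apply] at this
    rw [← this, ← e.sum_comp]
    simp)
  refine ⟨a, ?_, hT⟩
  ext i j
  simpa [Matrix.one_apply] using congrFun (congrFun hS (e i)) (e j)

/-- The array of `k` forms `∑ i, (i : ℝ) ^ l • xᵢ ∧ yᵢ` on a space of dimension `2 r`. -/
def diagonalPencil (r k : ℕ) : (Fin r ⊕ Fin r) × (Fin r ⊕ Fin r) × Fin k → ℝ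
  | (.inl i, .inr j, l) => if i = j then (i : ℝ) ^ (l : ℕ) else 0
  | (.inr i, .inl j, l) => if i = j then -(i : ℝ) ^ (l : ℕ) else 0
  | (.inl _, .inl _, _) => 0
  | (.inr _, .inr _, _) => 0

theorem diagonalPencil_skew (r k : ℕ) (i j : Fin r ⊕ Fin r) (l : Fin k) :
    diagonalPencil r k (i, j, l) = -diagonalPencil r k (j, i, l) := by
  rcases i with i | i <;> rcases j with j | j <;> simp only [diagonalPencil, neg_zero] <;>
    by_cases h : i = j <;> simp [h, eq_comm]

/-- A solution `(S, T)` of the centroid equations of `diagonalPencil`. -/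
theorem diagonalPencil_centroid {r k : ℕ} {S : Matrix (Fin r ⊕ Fin r) (Fin r ⊕ Fin r) ℝ}
    {T : Matrix (Fin (k + 1)) (Fin (k + 1)) ℝ}
    (h : ∀ i j l, ∑ p, S i p * diagonalPencil r (k + 1) (p, j, l) =
      ∑ q, T l q * diagonalPencil r (k + 1) (i, j, q)) :
    S = Matrix.diagonal (Sum.elim (fun i : Fin r => ∑ q, T 0 q * (i : ℝ) ^ (q : ℕ))
      (fun i : Fin r => ∑ q, T 0 q * (i : ℝ) ^ (q : ℕ))) ∧
    ∀ (i : Fin r) (l : Fin (k + 1)),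
      (∑ q, T 0 q * (i : ℝ) ^ (q : ℕ)) * (i : ℝ) ^ (l : ℕ) = ∑ q, T l q * (i : ℝ) ^ (q : ℕ) := by
  -- Each column of a form has at most one nonzero entry, so each equation isolates one entry of
  -- `S`. The form with `l = 0` is the standard symplectic one (`0 ^ 0 = 1` at `i = 0`), so `T 0`
  -- determines `S`.
  have hr : ∀ x j (l : Fin (k + 1)), S x (.inl j) * (j : ℝ) ^ (l : ℕ) =
      ∑ q, T l q * diagonalPencil r (k + 1) (x, .inr j, q) := fun x j l => by
    rw [← h]
    simp [diagonalPencil, Fintype.sum_sum_type]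
  have hl : ∀ x j (l : Fin (k + 1)), -(S x (.inr j) * (j : ℝ) ^ (l : ℕ)) =
      ∑ q, T l q * diagonalPencil r (k + 1) (x, .inl j, q) := fun x j l => by
    rw [← h]
    simp [diagonalPencil, Fintype.sum_sum_type]
  have h1 : ∀ i, S (.inl i) (.inl i) = ∑ q, T 0 q * (i : ℝ) ^ (q : ℕ) := fun i => by
    simpa [diagonalPencil] using hr (.inl i) i 0
  refine ⟨?_, fun i l => ?_⟩
  · ext (i | i) (j | j)
    · have := hr (.inl i) j 0
      by_cases hij : i = j
      · subst hij
        simp [h1]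
      · simpa [diagonalPencil, hij] using this
    · simpa [diagonalPencil] using hl (.inl i) j 0
    · simpa [diagonalPencil] using hr (.inr i) j 0
    · have := hl (.inr i) j 0
      by_cases hij : i = j
      · subst hij
        simpa [diagonalPencil] using this
      · simpa [diagonalPencil, hij] using this
  · rw [← h1, hr]
    simp [diagonalPencil]

theorem diagonalPencil_one_hasTrivialCentroid (r : ℕ) [NeZero r] :
    HasTrivialCentroid (diagonalPencil r 1) := by
  intro S T h
  obtain ⟨hS, -⟩ := diagonalPencil_centroid (k := 0) h
  refine ⟨T 0 0, ?_, ?_⟩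
  · rw [hS]
    ext (i | i) (j | j) <;> simp [Matrix.diagonal_apply, Matrix.one_apply]
  · ext i j
    fin_cases i
    fin_cases j
    simp

theorem diagonalPencil_two_hasTrivialCentroid {r : ℕ} (hr : 3 ≤ r) :
    HasTrivialCentroid (diagonalPencil r 2) := by
  intro S T h
  obtain ⟨hS, hT⟩ := diagonalPencil_centroid (k := 1) h
  -- Let f and g be the polynomials of degree at most 1 with coefficients `T 0` and `T 1`. Then x
  -- f(x) - g(x) has degree at most 2 and vanishes at 0, 1, 2, hence is zero. With r = 2 only two of
  -- these equations are available and the centroid is not trivial.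
  have e0 := hT ⟨0, by omega⟩ 1
  have e1 := hT ⟨1, by omega⟩ 1
  have e2 := hT ⟨2, by omega⟩ 1
  simp at e0 e1 e2
  have h01 : T 0 1 = 0 := by linarith
  have h11 : T 1 1 = T 0 0 := by linarith
  refine ⟨T 0 0, ?_, ?_⟩
  · rw [hS]
    ext (i | i) (j | j) <;> simp [Matrix.diagonal_apply, Matrix.one_apply, h01]
  · ext i j
    fin_cases i <;> fin_cases j <;> simp [h01, h11, ← e0]

end TrivialCentroid

/-! ### Families of forms with only scalar self-adjoint operators -/

section SelfAdjoint

variable {ι κ : Type*} [Fintype ι] [Fintype κ] [DecidableEq ι] [DecidableEq κ]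

/-- Only the scalar matrices are self-adjoint for all forms of the family `ω`. -/
def OnlyScalarSelfAdjoint (ω : κ → Matrix ι ι ℝ) : Prop :=
  ∀ S : Matrix ι ι ℝ, (∀ l, S * ω l = ω l * S.transpose) → ∃ a : ℝ, S = a • (1 : Matrix ι ι ℝ)

/-- For a centroid pair, S ω_l is a combination of the forms, hence skew, which says that S is
self-adjoint for ω_l. Once S is scalar, independence of the forms determines T. -/
theorem OnlyScalarSelfAdjoint.hasTrivialCentroid {ω : κ → Matrix ι ι ℝ}
    (h : OnlyScalarSelfAdjoint ω) (hskew : ∀ l, (ω l).transpose = -ω l)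
    (hω : LinearIndependent ℝ ω) : HasTrivialCentroid fun t : ι × ι × κ => ω t.2.2 t.1 t.2.1 := by
  intro S T hST
  have hST' : ∀ l, S * ω l = ∑ q, T l q • ω q := fun l => by
    ext i j
    rw [Matrix.mul_apply, hST, Matrix.sum_apply]
    rfl
  obtain ⟨a, rfl⟩ := h S fun l => by
    have h1 : (S * ω l).transpose = -(S * ω l) := by
      rw [hST', Matrix.transpose_sum, ← Finset.sum_neg_distrib]
      exact Finset.sum_congr rfl fun q _ => by rw [Matrix.transpose_smul, hskew, smul_neg]
    rw [Matrix.transpose_mul, hskew, Matrix.neg_mul] at h1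
    exact (neg_injective h1).symm
  refine ⟨a, rfl, ?_⟩
  ext l q
  have h0 : ∑ q, (T l q - (a • (1 : Matrix κ κ ℝ)) l q) • ω q = 0 := by
    simp only [sub_smul, Finset.sum_sub_distrib]
    rw [← hST', sub_eq_zero]
    simp [Matrix.one_apply]
  exact sub_eq_zero.mp (Fintype.linearIndependent_iff.mp hω _ h0 q)

/-- There are `k` linearly independent skew-symmetric forms, indexed by `ι`, for which only the
scalar matrices are self-adjoint. -/
def ExistsRigidForms (ι : Type*) [Fintype ι] [DecidableEq ι] (k : ℕ) : Prop :=
  ∃ ω : Fin k → Matrix ι ι ℝ, (∀ l, (ω l).transpose = -ω l) ∧ LinearIndependent ℝ ω ∧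
    OnlyScalarSelfAdjoint ω

theorem ExistsRigidForms.of_equiv {ι' : Type*} [Fintype ι'] [DecidableEq ι'] (e : ι' ≃ ι) {k : ℕ}
    (h : ExistsRigidForms ι k) : ExistsRigidForms ι' k := by
  obtain ⟨ω, hskew, hω, hS⟩ := h
  refine ⟨fun l => (ω l).submatrix e e, fun l => ?_, ?_, fun S h => ?_⟩
  · rw [Matrix.transpose_submatrix, hskew, Matrix.submatrix_neg]
    rfl
  · rw [Fintype.linearIndependent_iff] at hω ⊢
    intro g hg
    apply hω
    ext i j
    simpa [Matrix.sum_apply] using congrFun (congrFun hg (e.symm i)) (e.symm j)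
  · obtain ⟨a, ha⟩ := hS (S.submatrix e.symm e.symm) fun l => by
      have := congrArg (fun A : Matrix ι' ι' ℝ => A.submatrix e.symm e.symm) (h l)
      simpa [← Matrix.submatrix_mul_equiv _ _ _ e.symm] using this
    refine ⟨a, ?_⟩
    ext i j
    simpa [Matrix.one_apply] using congrFun (congrFun ha (e i)) (e j)

/-- Adding one basis vector and one form preserves rigidity. -/
theorem ExistsRigidForms.sum_unit [Nontrivial ι] {k : ℕ} (h : ExistsRigidForms ι k) :
    ExistsRigidForms (ι ⊕ Unit) (k + 1) := by
  obtain ⟨ω, hskew, hω, hS⟩ := h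
  let u : Matrix ι Unit ℝ := Matrix.of fun _ _ => 1
  let ω' : Fin (k + 1) → Matrix (ι ⊕ Unit) (ι ⊕ Unit) ℝ :=
    Fin.snoc (α := fun _ => Matrix (ι ⊕ Unit) (ι ⊕ Unit) ℝ)
      (fun l => Matrix.fromBlocks (ω l) 0 0 0) (Matrix.fromBlocks 0 u (-u.transpose) 0)
  have hc : ∀ l, ω' (Fin.castSucc l) = Matrix.fromBlocks (ω l) 0 0 0 := fun l => by simp [ω']
  have hl : ω' (Fin.last k) = Matrix.fromBlocks 0 u (-u.transpose) 0 := by simp [ω']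
  obtain ⟨i₀⟩ : Nonempty ι := inferInstance
  refine ⟨ω', fun l => ?_, ?_, fun S h => ?_⟩
  · refine Fin.lastCases ?_ (fun l => ?_) l
    · rw [hl, Matrix.fromBlocks_transpose, Matrix.fromBlocks_neg]
      simp
    · rw [hc, Matrix.fromBlocks_transpose, Matrix.fromBlocks_neg]
      simp [hskew]
  · rw [Fintype.linearIndependent_iff] at hω ⊢
    intro g hg
    rw [Fin.sum_univ_castSucc] at hg
    simp only [hc, hl] at hg
    have hlast : g (Fin.last k) = 0 := by
      simpa [Matrix.sum_apply, u] using congrFun (congrFun hg (.inl i₀)) (.inr ())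
    refine fun l => Fin.lastCases hlast (fun l => ?_) l
    refine hω (fun l => g (Fin.castSucc l)) ?_ l
    ext i j
    simpa [Matrix.sum_apply] using congrFun (congrFun hg (.inl i)) (.inl j)
  · obtain ⟨A, b, c, d, rfl⟩ : ∃ A b c d, S = Matrix.fromBlocks A b c d :=
      ⟨_, _, _, _, (Matrix.fromBlocks_toBlocks S).symm⟩
    have hcs := fun l => h (Fin.castSucc l)
    have hla := h (Fin.last k)
    simp only [hc, Matrix.fromBlocks_transpose, Matrix.fromBlocks_multiply, Matrix.mul_zero,
      Matrix.zero_mul, add_zero, Matrix.fromBlocks_inj] at hcs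
    simp only [hl, Matrix.fromBlocks_transpose, Matrix.fromBlocks_multiply, Matrix.mul_zero,
      Matrix.zero_mul, add_zero, zero_add, Matrix.fromBlocks_inj] at hla
    obtain ⟨a, rfl⟩ := hS A fun l => (hcs l).1
    -- The old forms give c ω_l = 0, so u c is self-adjoint for all of them and hence scalar. All
    -- its rows equal c, so an off-diagonal entry in each column shows c = 0.
    have hc0 : c = 0 := by
      obtain ⟨a', ha'⟩ := hS (u * c) fun l => by
        rw [Matrix.mul_assoc, (hcs l).2.2.1, Matrix.transpose_mul, ← Matrix.mul_assoc,
          ← (hcs l).2.1]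
        simp
      ext ⟨⟩ j
      obtain ⟨i, hi⟩ := exists_ne j
      simpa [Matrix.mul_apply, u, Matrix.one_apply, hi] using congrFun (congrFun ha' i) j
    -- The new form gives -b uᵀ = u bᵀ, whose diagonal entries read -b_i = b_i; its off-diagonal
    -- block then gives d = a.
    have hb0 : b = 0 := by
      ext i ⟨⟩
      have := congrFun (congrFun hla.1 i) i
      simp [Matrix.mul_apply, u] at this
      simp only [Matrix.zero_apply]
      linarith
    have hd : d = a • (1 : Matrix Unit Unit ℝ) := by
      ext ⟨⟩ ⟨⟩
      have := congrFun (congrFun hla.2.1 i₀) ()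
      rw [Matrix.smul_mul, Matrix.one_mul] at this
      simp [Matrix.mul_apply, u] at this
      simp [this]
    refine ⟨a, ?_⟩
    rw [hc0, hb0, hd, ← Matrix.fromBlocks_one, Matrix.fromBlocks_smul]
    simp

end SelfAdjoint

/-! ### Adding further independent forms -/

/-- The space of skew-symmetric matrices. -/
def skewMatrices (m : ℕ) : Submodule ℝ (Matrix (Fin m) (Fin m) ℝ) where
  carrier := {A | A.transpose = -A}
  add_mem' := fun {A B} hA hB => by
    rw [Set.mem_ofPred_eq] at *
    rw [Matrix.transpose_add, hA, hB, neg_add]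
  zero_mem' := by simp
  smul_mem' := fun a A hA => by
    rw [Set.mem_ofPred_eq] at *
    rw [Matrix.transpose_smul, hA, smul_neg]

theorem le_finrank_skewMatrices (m : ℕ) :
    m * (m - 1) / 2 ≤ Module.finrank ℝ (skewMatrices m) := by
  let f : ((Σ j : Fin m, Fin j) → ℝ) →ₗ[ℝ] skewMatrices m :=
    { toFun := fun v => ⟨Matrix.of fun i j => if h : i < j then v ⟨j, ⟨i, h⟩⟩ else
            if h : j < i then -v ⟨i, ⟨j, h⟩⟩ else 0, by
        ext i j
        rcases lt_trichotomy i j with h | h | h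
        · simp [Matrix.transpose_apply, h, h.not_gt]
        · simp [Matrix.transpose_apply, h]
        · simp [Matrix.transpose_apply, h, h.not_gt]⟩
      map_add' := fun v w => by
        ext i j
        rcases lt_trichotomy i j with h | h | h
        · simp [h]
        · simp [h]
        · simp only [Matrix.of_apply, h, h.not_gt, dite_true, dite_false, Submodule.coe_add,
            Matrix.add_apply, Pi.add_apply, neg_add]
      map_smul' := fun a v => by
        ext i j
        rcases lt_trichotomy i j with h | h | h
        · simp [h]
        · simp [h]
        · simp [h, h.not_gt] }
  have hf : Function.Injective f := by
    intro v w hvw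
    ext ⟨j, i, hi⟩
    have := congrFun (congrFun (congrArg Subtype.val hvw) ⟨i, hi.trans j.2⟩) j
    have hij : (⟨i, hi.trans j.2⟩ : Fin m) < j := hi
    simpa [f, hij] using this
  have := LinearMap.finrank_le_finrank_of_injective hf
  rw [Module.finrank_fintype_fun_eq_card, Fintype.card_sigma] at this
  simp only [Fintype.card_fin] at this
  rwa [Fin.sum_univ_eq_sum_range (fun i => i), Finset.sum_range_id] at this

/-- An extra form only adds conditions on S; the bound on k leaves room for an independent skew
form. -/
theorem ExistsRigidForms.succ {m k : ℕ} (h : ExistsRigidForms (Fin m) k)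
    (hk : k < m * (m - 1) / 2) : ExistsRigidForms (Fin m) (k + 1) := by
  obtain ⟨ω, hskew, hω, hS⟩ := h
  let ω' : Fin k → skewMatrices m := fun l => ⟨ω l, hskew l⟩
  have hω' : LinearIndependent ℝ ω' := LinearIndependent.of_comp (skewMatrices m).subtype hω
  obtain ⟨A, hA⟩ := exists_linearIndependent_snoc_of_lt_finrank hω'
    (hk.trans_le (le_finrank_skewMatrices m))
  refine ⟨fun l => (Fin.snoc (α := fun _ => skewMatrices m) ω' A l : skewMatrices m),
    fun l => (Fin.snoc (α := fun _ => skewMatrices m) ω' A l : skewMatrices m).2,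
    hA.map' (skewMatrices m).subtype (Submodule.ker_subtype _), fun S h => hS S fun l => ?_⟩
  simpa [ω'] using h (Fin.castSucc l)

theorem ExistsRigidForms.mono {m k k' : ℕ} (h : ExistsRigidForms (Fin m) k) (hk : k ≤ k')
    (hk' : k' ≤ m * (m - 1) / 2) : ExistsRigidForms (Fin m) k' := by
  induction k', hk using Nat.le_induction with
  | base => exact h
  | succ k' _ ih => exact (ih (by omega)).succ (by omega)

/-! ### The Kronecker pencil in odd dimension -/

/-- A Toeplitz matrix with zero last row (left of the diagonal) and zero first row (right of the
diagonal) is scalar. -/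
theorem toeplitz_eq_scalar {r : ℕ} {A : Matrix (Fin (r + 1)) (Fin (r + 1)) ℝ}
    (hT : ∀ i j : Fin r, A i.succ j.succ = A i.castSucc j.castSucc)
    (hlast : ∀ j : Fin r, A (Fin.last r) j.castSucc = 0) (hfirst : ∀ j : Fin r, A 0 j.succ = 0) :
    A = A 0 0 • (1 : Matrix (Fin (r + 1)) (Fin (r + 1)) ℝ) := by
  have hdiag : ∀ i, A i i = A 0 0 := fun i => by
    induction i using Fin.induction with
    | zero => rfl
    | succ i ih => rw [hT, ih]
  have hup : ∀ i j, i < j → A i j = 0 := fun i => by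
    induction i using Fin.induction with
    | zero =>
      intro j hj
      obtain ⟨j, rfl⟩ := Fin.exists_succ_eq_of_ne_zero hj.ne'
      exact hfirst j
    | succ i ih =>
      intro j hj
      obtain ⟨j, rfl⟩ := Fin.exists_succ_eq_of_ne_zero (Fin.ne_zero_of_lt hj)
      rw [hT]
      exact ih _ (by simpa using hj)
  have hlow : ∀ i j, j < i → A i j = 0 := fun i => by
    induction i using Fin.reverseInduction with
    | last =>
      intro j hj
      obtain ⟨j, rfl⟩ := Fin.exists_castSucc_eq.mpr hj.ne
      exact hlast j
    | cast i ih =>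
      intro j hj
      obtain ⟨j, rfl⟩ := Fin.exists_castSucc_eq.mpr
        (hj.trans (Fin.castSucc_lt_last i)).ne
      rw [← hT]
      exact ih _ (by simpa using hj)
  ext i j
  rcases lt_trichotomy i j with h | rfl | h
  · simp [hup i j h, h.ne]
  · simp [hdiag]
  · simp [hlow i j h, h.ne']

/-- If `B` and its shift are both skew-symmetric and the boundary rows vanish, then `B = 0`. -/
theorem eq_zero_of_skew_shift_rows {r : ℕ} {B : Matrix (Fin (r + 1)) (Fin r) ℝ}
    (h1 : ∀ i j : Fin r, B i.castSucc j = -B j.castSucc i)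
    (h2 : ∀ i j : Fin r, B i.succ j = -B j.succ i)
    (hlast : ∀ j, B (Fin.last r) j = 0) (hfirst : ∀ j, B 0 j = 0) : B = 0 := by
  suffices ∀ i j, B i j = 0 by
    ext i j
    exact this i j
  intro i
  induction i using Fin.induction with
  | zero => exact hfirst
  | succ i ih =>
    intro j
    -- The two symmetries combine to B(i+1, j) = -B(j+1, i) = B(i, j+1), which lies in the preceding
    -- row; if j+1 is the last row, the middle term already vanishes.
    rw [h2]
    rcases eq_or_ne j.succ (Fin.last r) with hj | hj
    · rw [hj, hlast, neg_zero]
    · obtain ⟨j', hj'⟩ := Fin.exists_castSucc_eq.mpr hj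
      rw [← hj', h1, neg_neg, ih]

/-- If the matrices of the first and of the last `r` columns of `C` are both skew-symmetric, then
`C = 0`. -/
theorem eq_zero_of_skew_shift_cols {r : ℕ} {C : Matrix (Fin r) (Fin (r + 1)) ℝ}
    (h1 : ∀ i j : Fin r, C i j.castSucc = -C j i.castSucc)
    (h2 : ∀ i j : Fin r, C i j.succ = -C j i.succ) : C = 0 := by
  -- Induction on the offset d = j - i: offsets 0 and 1 are the diagonals of the two skew matrices,
  -- and C(i, j+1) = -C(j, i+1) = C(i+1, j) lowers the offset by 2. Entries below the diagonal are
  -- reflected by `h1`.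
  have key : ∀ (d : ℕ) (i : Fin r) (j : Fin (r + 1)), (j : ℕ) = i + d → C i j = 0 := by
    intro d
    induction d using Nat.strong_induction_on with
    | _ d ih =>
      intro i j hj
      match d, ih, hj with
      | 0, _, hj =>
        obtain rfl : j = i.castSucc := Fin.ext (by simpa using hj)
        linarith [h1 i i]
      | 1, _, hj =>
        obtain rfl : j = i.succ := Fin.ext (by simpa using hj)
        linarith [h2 i i]
      | d + 2, ih, hj =>
        obtain ⟨j, rfl⟩ := Fin.exists_succ_eq_of_ne_zero (x := j) (by
          rintro rfl
          simp at hj)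
        rw [Fin.val_succ] at hj
        have hi : (i : ℕ) + 1 < r := by omega
        have hi' : i.succ = Fin.castSucc ⟨i + 1, hi⟩ := Fin.ext rfl
        rw [h2, hi', h1, neg_neg]
        refine ih d (by omega) _ _ ?_
        simp only [Fin.val_castSucc]
        omega
  ext i j
  rcases le_or_gt (i : ℕ) j with h | h
  · exact key _ i j (Nat.add_sub_cancel' h).symm
  · have hjr : (j : ℕ) < r := by omega
    obtain ⟨j, rfl⟩ : ∃ j', j = Fin.castSucc j' := ⟨⟨j, hjr⟩, Fin.ext rfl⟩
    rw [h1, key (i - j) _ _ (by simp at h ⊢; omega)]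
    simp

/-- The `(r + 1) × r` matrix consisting of the identity matrix and a zero row at the bottom. -/
def upperIdentity (r : ℕ) : Matrix (Fin (r + 1)) (Fin r) ℝ :=
  Matrix.of fun a b => if a = b.castSucc then 1 else 0

/-- The `(r + 1) × r` matrix consisting of the identity matrix and a zero row at the top. -/
def lowerIdentity (r : ℕ) : Matrix (Fin (r + 1)) (Fin r) ℝ :=
  Matrix.of fun a b => if a = b.succ then 1 else 0

section

variable {r : ℕ} {ι : Type*}

theorem mul_upperIdentity_apply (A : Matrix ι (Fin (r + 1)) ℝ) (i : ι) (j : Fin r) :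
    (A * upperIdentity r) i j = A i j.castSucc := by
  simp [Matrix.mul_apply, upperIdentity]

theorem mul_lowerIdentity_apply (A : Matrix ι (Fin (r + 1)) ℝ) (i : ι) (j : Fin r) :
    (A * lowerIdentity r) i j = A i j.succ := by
  simp [Matrix.mul_apply, lowerIdentity]

theorem upperIdentity_mul_castSucc (A : Matrix (Fin r) ι ℝ) (i : Fin r) (j : ι) :
    (upperIdentity r * A) i.castSucc j = A i j := by
  simp [Matrix.mul_apply, upperIdentity]

theorem upperIdentity_mul_last (A : Matrix (Fin r) ι ℝ) (j : ι) :
    (upperIdentity r * A) (Fin.last r) j = 0 := by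
  simp [Matrix.mul_apply, upperIdentity, (Fin.castSucc_lt_last _).ne']

theorem lowerIdentity_mul_succ (A : Matrix (Fin r) ι ℝ) (i : Fin r) (j : ι) :
    (lowerIdentity r * A) i.succ j = A i j := by
  simp [Matrix.mul_apply, lowerIdentity]

theorem lowerIdentity_mul_zero (A : Matrix (Fin r) ι ℝ) (j : ι) :
    (lowerIdentity r * A) 0 j = 0 := by
  simp [Matrix.mul_apply, lowerIdentity, (Fin.succ_ne_zero _).symm]

end

/-- The Kronecker pencil of skew-symmetric forms in odd dimension is rigid. -/
theorem existsRigidForms_kronecker {r : ℕ} (hr : 0 < r) :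
    ExistsRigidForms (Fin (r + 1) ⊕ Fin r) 2 := by
  refine ⟨![Matrix.fromBlocks 0 (upperIdentity r) (-(upperIdentity r).transpose) 0,
      Matrix.fromBlocks 0 (lowerIdentity r) (-(lowerIdentity r).transpose) 0],
    fun l => ?_, ?_, fun S hS => ?_⟩
  · fin_cases l <;> simp [Matrix.fromBlocks_transpose, Matrix.fromBlocks_neg]
  · rw [LinearIndependent.pair_iff]
    intro s t hst
    have e1 := congrFun (congrFun hst (.inl (Fin.castSucc ⟨0, hr⟩))) (.inr ⟨0, hr⟩)
    have e2 := congrFun (congrFun hst (.inl (Fin.succ ⟨0, hr⟩))) (.inr ⟨0, hr⟩)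
    simp [upperIdentity, lowerIdentity, Fin.ext_iff] at e1 e2
    exact ⟨e1, e2⟩
  -- For U either of the two shifted identities, self-adjointness says A U = U Dᵀ, while B Uᵀ and C
  -- U are skew. Comparing the two choices makes A Toeplitz with vanishing boundary entries, hence
  -- scalar, and forces B = C = 0; then D follows from A.
  · obtain ⟨A, B, C, D, rfl⟩ : ∃ A B C D, S = Matrix.fromBlocks A B C D :=
      ⟨_, _, _, _, (Matrix.fromBlocks_toBlocks S).symm⟩
    have hS₁ := hS 0
    have hS₂ := hS 1
    simp only [Matrix.cons_val_zero, Matrix.cons_val_one, Matrix.fromBlocks_transpose,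
      Matrix.fromBlocks_multiply, Matrix.mul_zero, Matrix.zero_mul, add_zero, zero_add,
      Matrix.fromBlocks_inj, Matrix.mul_neg, Matrix.neg_mul] at hS₁ hS₂
    obtain ⟨b₁, a₁, -, c₁⟩ := hS₁
    obtain ⟨b₂, a₂, -, c₂⟩ := hS₂
    have b₁' : ∀ i j, (B * (upperIdentity r).transpose) i j =
        -(upperIdentity r * B.transpose) i j := fun i j =>
      neg_eq_iff_eq_neg.mp (congrFun (congrFun b₁ i) j)
    have b₂' : ∀ i j, (B * (lowerIdentity r).transpose) i j =
        -(lowerIdentity r * B.transpose) i j := fun i j =>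
      neg_eq_iff_eq_neg.mp (congrFun (congrFun b₂ i) j)
    rw [show B * (upperIdentity r).transpose = (upperIdentity r * B.transpose).transpose by simp] at b₁'
    rw [show B * (lowerIdentity r).transpose = (lowerIdentity r * B.transpose).transpose by simp] at b₂'
    rw [← Matrix.transpose_mul] at c₁ c₂
    have hA₁ : ∀ i j : Fin r, A i.castSucc j.castSucc = D j i := fun i j => by
      rw [← mul_upperIdentity_apply A, a₁, upperIdentity_mul_castSucc, Matrix.transpose_apply]
    have hA₂ : ∀ i j : Fin r, A i.succ j.succ = D j i := fun i j => by
      rw [← mul_lowerIdentity_apply A, a₂, lowerIdentity_mul_succ, Matrix.transpose_apply]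
    have hA := toeplitz_eq_scalar (A := A) (fun i j => (hA₂ i j).trans (hA₁ i j).symm)
      (fun j => by rw [← mul_upperIdentity_apply A, a₁, upperIdentity_mul_last])
      (fun j => by rw [← mul_lowerIdentity_apply A, a₂, lowerIdentity_mul_zero])
    have hB : B = 0 := by
      refine eq_zero_of_skew_shift_rows (fun i j => ?_) (fun i j => ?_) (fun j => ?_) (fun j => ?_)
      · have := b₁' i.castSucc j.castSucc
        rw [Matrix.transpose_apply] at this
        rwa [upperIdentity_mul_castSucc, upperIdentity_mul_castSucc, Matrix.transpose_apply,
          Matrix.transpose_apply] at this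
      · have := b₂' i.succ j.succ
        rw [Matrix.transpose_apply] at this
        rwa [lowerIdentity_mul_succ, lowerIdentity_mul_succ, Matrix.transpose_apply,
          Matrix.transpose_apply] at this
      · have := b₁' (Fin.last r) j.castSucc
        rw [Matrix.transpose_apply] at this
        rwa [upperIdentity_mul_castSucc, upperIdentity_mul_last, neg_zero] at this
      · have := b₂' 0 j.succ
        rw [Matrix.transpose_apply] at this
        rwa [lowerIdentity_mul_succ, lowerIdentity_mul_zero, neg_zero] at this
    have hC : C = 0 := by
      refine eq_zero_of_skew_shift_cols (fun i j => ?_) (fun i j => ?_)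
      · rw [← mul_upperIdentity_apply C, c₁, Matrix.neg_apply, Matrix.transpose_apply,
          mul_upperIdentity_apply]
      · rw [← mul_lowerIdentity_apply C, c₂, Matrix.neg_apply, Matrix.transpose_apply,
          mul_lowerIdentity_apply]
    have hD : D = A 0 0 • (1 : Matrix (Fin r) (Fin r) ℝ) := by
      ext i j
      rw [← hA₁, hA]
      simp [Matrix.one_apply, eq_comm]
    refine ⟨A 0 0, ?_⟩
    rw [hB, hC, hD, ← Matrix.fromBlocks_one, Matrix.fromBlocks_smul, smul_zero, smul_zero, ← hA]

/-! ### Choice of the array in each case -/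

theorem existsRigidForms_of_odd {m k : ℕ} (hm : 3 ≤ m) (hodd : Odd m) (hk : 2 ≤ k)
    (hk' : k ≤ m * (m - 1) / 2) : ExistsRigidForms (Fin m) k := by
  obtain ⟨r, rfl⟩ := hodd
  refine ExistsRigidForms.mono ?_ hk hk'
  exact (existsRigidForms_kronecker (r := r) (by omega)).of_equiv
    ((finCongr (by omega)).trans finSumFinEquiv.symm)

/-- The Kronecker pencil in odd dimension m - 1 gains one vector and one form. Starting at k = 3 is
natural: for a pair with ω₁ invertible, ω₂ ω₁⁻¹ is self-adjoint for both forms and is not scalar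
when they are independent. Hence k = 2 needs the diagonal pencil, where T also enters. -/
theorem existsRigidForms_of_even {m k : ℕ} (hm : 4 ≤ m) (heven : Even m) (hk : 3 ≤ k)
    (hk' : k ≤ m * (m - 1) / 2) : ExistsRigidForms (Fin m) k := by
  obtain ⟨m, rfl⟩ : ∃ m', m = m' + 1 := ⟨m - 1, by omega⟩
  refine ExistsRigidForms.mono ?_ hk hk'
  have hodd : Odd m := by
    rw [Nat.even_add_one, Nat.not_even_iff_odd] at heven
    exact heven
  have : Nontrivial (Fin m) := Fin.nontrivial_iff_two_le.mpr (by omega)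
  have h2 : 2 ≤ m * (m - 1) / 2 := by
    rw [Nat.le_div_iff_mul_le two_pos]
    exact Nat.mul_le_mul (show 2 ≤ m by omega) (show 2 ≤ m - 1 by omega)
  exact (existsRigidForms_of_odd (by omega) hodd le_rfl h2).sum_unit.of_equiv
    (finSumFinEquiv.symm.trans (Equiv.sumCongr (Equiv.refl _) finOneEquiv))

/-- In all cases but the exceptional ones there is an array of structure constants whose centroid is
trivial. -/
theorem exists_hasTrivialCentroid {m k : ℕ} (hm : 2 ≤ m) (hk : 0 < k) (hk' : k ≤ m * (m - 1) / 2)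
    (h₁ : k = 1 → Even m) (h₂ : ¬ (m = 4 ∧ k = 2)) :
    ∃ c : Fin m × Fin m × Fin k → ℝ, (∀ i j l, c (i, j, l) = -c (j, i, l)) ∧
      HasTrivialCentroid c := by
  have rigid : ExistsRigidForms (Fin m) k → ∃ c : Fin m × Fin m × Fin k → ℝ,
      (∀ i j l, c (i, j, l) = -c (j, i, l)) ∧ HasTrivialCentroid c := by
    rintro ⟨ω, hskew, hω, hS⟩
    refine ⟨_, fun i j l => ?_, hS.hasTrivialCentroid hskew hω⟩
    exact congrFun (congrFun (hskew l) j) i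
  rcases Nat.even_or_odd m with heven | hodd
  · obtain ⟨r, hr⟩ := heven
    have pencil : HasTrivialCentroid (diagonalPencil r k) →
        ∃ c : Fin m × Fin m × Fin k → ℝ, (∀ i j l, c (i, j, l) = -c (j, i, l)) ∧
          HasTrivialCentroid c := fun h =>
      ⟨_, fun i j l => diagonalPencil_skew r k _ _ l,
        h.comp_equiv ((finCongr hr).trans finSumFinEquiv.symm)⟩
    rcases (show k = 1 ∨ k = 2 ∨ 3 ≤ k by omega) with rfl | rfl | hk3
    · have : NeZero r := ⟨by omega⟩
      exact pencil (diagonalPencil_one_hasTrivialCentroid r)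
    · have hm2 : m ≠ 2 := by
        rintro rfl
        simp at hk'
      -- Here m is even and different from 2 and, by `h₂`, from 4, so m = 2r with r ≥ 3.
      exact pencil (diagonalPencil_two_hasTrivialCentroid (by omega))
    · have hm2 : m ≠ 2 := by
        rintro rfl
        simp at hk'
        omega
      exact rigid (existsRigidForms_of_even (by omega) ⟨r, hr⟩ hk3 hk')
  · have hk1 : k ≠ 1 := fun h => (Nat.not_even_iff_odd.mpr hodd) (h₁ h)
    have hm2 : m ≠ 2 := by
      rintro rfl
      exact absurd hodd (by decide)
    exact rigid (existsRigidForms_of_odd (by omega) hodd (by omega) hk')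

theorem mainTheorem8 (m n : ℕ) (hm : 2 ≤ m) (hmn : m < n) (hn : n ≤ m * (m + 1) / 2)
    (h₁ : ¬ (n = m + 1 ∧ Even n)) (h₂ : ¬ (m = 4 ∧ n = 6)) :
    GNLA.IsGeneric (fun g : GNLA.{u} m n => ¬ g.IsDecomposable) := by
  -- Since m(m+1) = m(m-1) + 2m, the bound on n says that n - m is at most the dimension of the
  -- space of skew forms.
  have hk : n - m ≤ m * (m - 1) / 2 := by
    obtain ⟨d, rfl⟩ : ∃ d, m = d + 1 := ⟨m - 1, by omega⟩
    have : (d + 1) * (d + 1 + 1) = (d + 1) * (d + 1 - 1) + 2 * (d + 1) := by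
      rw [Nat.add_sub_cancel]
      ring
    omega
  obtain ⟨c, hskew, hc⟩ := exists_hasTrivialCentroid hm (Nat.sub_pos_of_lt hmn) hk
    (fun h => by
      have hn' : n = m + 1 := by omega
      by_contra hm'
      exact h₁ ⟨hn', hn' ▸ Nat.even_add_one.mpr hm'⟩)
    (fun h => h₂ ⟨h.1, by omega⟩)
  exact GNLA.isGeneric_of_hasTrivialCentroid (by omega) hmn hskew hc
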